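/- Let $d\ge 0$, $n\ge 1$ be integers, let $q>1$, and let $\mathcal S\subset\{0,1\}^d$ be a non-empty set of actions whose convex hull $\mathrm{Conv}(\mathcal S)$ meets $(0,+\infty)^d$ (equivalently, for every $i$ some $v\in\mathcal S$ has $v_i=1$). **Semi-bandit game.** In each round $t=1,\dots,n$ the forecaster draws an action $V_t\in\mathcal S$ from a distribution $p_t$ on $\mathcal S$, while the adversary simultaneously selects a loss vector $\ell_t\in[0,+\infty)^d$, possibly at random and depending on the past; that is, conditionally on the past, $p_t$ and $\ell_t$, the law of $V_t$ is $p_t$. The forecaster incurs the loss $\ell_t^TV_t$ and observes the coordinates $\ell_{i,t}$ with $V_{i,t}=1$. The regret is $$\overline R_n=\mathbb E\sum_{t=1}^n \ell_t^TV_t-\min_{v\in\mathcal S}\mathbb E\sum_{t=1}^n \ell_t^Tv .$$ **LINPOLY.** Let $\eta=\sqrt{\frac{2}{q(q-1)n}}$, let $\psi(x)=(-\eta x)^{-q}$ for $x<0$, and let $F(u)=\sum_{i=1}^d\int_0^{u_i}\psi^{-1}(s)\,ds=-\frac{q}{(q-1)\eta}\sum_{i=1}^d u_i^{\frac{q-1}{q}}$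 on $[0,+\infty)^d$, with Bregman divergence $D_F(u,v)=F(u)-F(v)-(u-v)^T\nabla F(v)$ for $u\in[0,+\infty)^d$, $v\in(0,+\infty)^d$. The forecaster starts from a point $w_1\in \mathrm{Conv}(\mathcal S)\cap(0,+\infty)^d$ which minimises $D_F\big(w,(1,\dots,1)^T\big)$ over $w\in\mathrm{Conv}(\mathcal S)$. In each round $t=1,\dots,n$ it takes for $p_t$ any distribution on $\mathcal S$ with mean $\mathbb E_{V\sim p_t}V=w_t$, draws $V_t\sim p_t$, forms the estimate $\tilde\ell_{i,t}=\ell_{i,t}\frac{V_{i,t}}{w_{i,t}}$ for $i=1,\dots,d$, takes $w'_{t+1}\in(0,+\infty)^d$ with $\nabla F(w'_{t+1})=\nabla F(w_t)-\tilde\ell_t$, and takes for $w_{t+1}$ a minimiser of $D_F(w,w'_{t+1})$ over $w\in\mathrm{Conv}(\mathcal S)\cap(0,+\infty)^d$. **Claim.** Under the $L_\infty$ assumption, i.e. $\|\ell_t\|_\infty\le 1$ for $t=1,\dots,n$, this forecaster satisfies $$\overline R_n\le d\sqrt{\frac{2qn}{q-1}} .$$ -/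

import Mathlib

open MeasureTheory ProbabilityTheory
open scoped Gradient

noncomputable section

/-- `x` is a minimiser of `f` over the set `s`. -/
def IsArgminOn {α : Type*} (f : α → ℝ) (s : Set α) (x : α) : Prop :=
  x ∈ s ∧ IsMinOn f s x

/-- Bregman divergence `D_F(u, v) = F u - F v - (u - v)ᵀ ∇F(v)`. -/
def bregmanDiv {d : ℕ} (F : EuclideanSpace ℝ (Fin d) → ℝ)
    (u v : EuclideanSpace ℝ (Fin d)) : ℝ :=
  F u - F v - inner ℝ (u - v) (∇ F v)

/-- One trajectory of the forecaster CLEB (combinatorial learning with Bregman projections) with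
potential `F` on the domain `D` and action set `S`, run for the `n` rounds `t = 0, …, n - 1`:
`w t` is the weight vector, `p t` the distribution on `S` used to draw the action of round `t`,
and `est t` the loss estimate formed at the end of round `t`. -/
structure IsCleb {d : ℕ} (D : Set (EuclideanSpace ℝ (Fin d)))
    (F : EuclideanSpace ℝ (Fin d) → ℝ) (S : Finset (EuclideanSpace ℝ (Fin d))) (n : ℕ)
    (est w : ℕ → EuclideanSpace ℝ (Fin d)) (p : ℕ → EuclideanSpace ℝ (Fin d) → ℝ) : Prop where
  init_mem : w 0 ∈ convexHull ℝ (S : Set (EuclideanSpace ℝ (Fin d))) ∩ interior D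
  /-- `p t` is a probability distribution on `S` with mean `w t`. -/
  prob_nonneg : ∀ t < n, ∀ v ∈ S, 0 ≤ p t v
  prob_sum : ∀ t < n, ∑ v ∈ S, p t v = 1
  prob_mean : ∀ t < n, ∑ v ∈ S, p t v • v = w t
  /-- Gradient step in the dual, followed by a Bregman projection. -/
  update : ∀ t < n, ∃ w' ∈ interior D, ∇ F w' = ∇ F (w t) - est t ∧
    IsArgminOn (fun u => bregmanDiv F u w')
      (convexHull ℝ (S : Set (EuclideanSpace ℝ (Fin d))) ∩ interior D) (w (t + 1))

/-- The domain `[ω, +∞)^d`. -/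
def orthant (d : ℕ) (ω : ℝ) : Set (EuclideanSpace ℝ (Fin d)) :=
  {u | ∀ i, ω ≤ u i}

/-- The function `F(u) = ∑ i, ∫_ω^{u_i} ψ⁻¹(s) ds` attached to a potential
`ψ : (-∞, a) → (ω, +∞)`. -/
def lininfF {d : ℕ} (ψ : ℝ → ℝ) (a ω : ℝ) (u : EuclideanSpace ℝ (Fin d)) : ℝ :=
  ∑ i, ∫ s in ω..u i, Function.invFunOn ψ (Set.Iio a) s

/-- The polynomial potential `ψ(x) = (-η x)^{-q}`, to be used on `(-∞, 0)`. -/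
def polyPotential (q η : ℝ) (x : ℝ) : ℝ :=
  (-η * x) ^ (-q)

/-- The function `F` of the forecaster LINPOLY, on the domain `[0, +∞)^d`. -/
def linpolyF {d : ℕ} (q η : ℝ) : EuclideanSpace ℝ (Fin d) → ℝ :=
  lininfF (polyPotential q η) 0 0

/-- The importance-weighted loss estimate `ℓ i * V i / w i`. For `V ∈ {0,1}^d` it only uses the
coordinates `ℓ i` with `V i = 1`, those that are observed in the semi-bandit game. -/
def importanceWeighted {d : ℕ} (ℓ V w : EuclideanSpace ℝ (Fin d)) : EuclideanSpace ℝ (Fin d) :=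
  WithLp.toLp 2 fun i => ℓ i * (V i / w i)

/-- The combinatorial prediction game over `n` rounds `t = 0, …, n - 1`, against an arbitrary
(adaptive, possibly randomised) adversary. `𝒢 t` is all the information that exists just before
the action of round `t` is drawn: the past actions and losses, the distribution `p t` chosen by
the forecaster, and the loss vector `ℓ t` chosen simultaneously by the adversary. Given `𝒢 t`,
the action `V t` is drawn from `p t`. -/
structure IsGamePlay {d : ℕ} {Ω : Type*} [mΩ : MeasurableSpace Ω] (μ : Measure Ω)
    (𝒢 : Filtration ℕ mΩ) (S : Finset (EuclideanSpace ℝ (Fin d))) (n : ℕ)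
    (ℓ V : ℕ → Ω → EuclideanSpace ℝ (Fin d))
    (p : ℕ → Ω → EuclideanSpace ℝ (Fin d) → ℝ) : Prop where
  loss_nonneg : ∀ t < n, ∀ ω i, 0 ≤ ℓ t ω i
  loss_measurable : ∀ t < n, Measurable[𝒢 t] (ℓ t)
  prob_measurable : ∀ t < n, ∀ v ∈ S, Measurable[𝒢 t] (fun ω => p t ω v)
  action_mem : ∀ t < n, ∀ ω, V t ω ∈ S
  action_measurable : ∀ t < n, Measurable[𝒢 (t + 1)] (V t)
  action_law : ∀ t < n, ∀ v ∈ S,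
    μ[(V t ⁻¹' {v}).indicator (fun _ => (1 : ℝ)) | 𝒢 t] =ᵐ[μ] fun ω => p t ω v

/-- The `L_∞` assumption: `‖ℓ_t‖_∞ ≤ 1` in every round (the norm of `Fin d → ℝ` is the
sup norm). -/
def LInftyAssumption {d : ℕ} {Ω : Type*} (n : ℕ) (ℓ : ℕ → Ω → EuclideanSpace ℝ (Fin d)) : Prop :=
  ∀ t < n, ∀ ω, ‖WithLp.ofLp (ℓ t ω)‖ ≤ 1

/-- The regret `E ∑ t, ℓ_tᵀ V_t - min_{v ∈ S} E ∑ t, ℓ_tᵀ v`. -/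
def regret {d : ℕ} {Ω : Type*} [MeasurableSpace Ω] (μ : Measure Ω)
    (S : Finset (EuclideanSpace ℝ (Fin d))) (hS : S.Nonempty) (n : ℕ)
    (ℓ V : ℕ → Ω → EuclideanSpace ℝ (Fin d)) : ℝ :=
  (∫ ω, ∑ t ∈ Finset.range n, inner ℝ (ℓ t ω) (V t ω) ∂μ) -
    S.inf' hS (fun v => ∫ ω, ∑ t ∈ Finset.range n, inner ℝ (ℓ t ω) v ∂μ)

/-- The inverse of the polynomial potential is `s ↦ -(1/η) s^{-1/q}` on `(0, +∞)`. -/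
theorem invFunOn_polyPotential {q η : ℝ} (hq : 1 < q) (hη : 0 < η) {s : ℝ} (hs : 0 < s) :
    Function.invFunOn (polyPotential q η) (Set.Iio 0) s = -(1 / η) * s ^ (-(1 / q)) := by
  have hq0 : q ≠ 0 := by positivity
  have hpre : polyPotential q η (-(1 / η) * s ^ (-(1 / q))) = s := by
    have h : -η * (-(1 / η) * s ^ (-(1 / q))) = s ^ (-(1 / q)) := by field_simp
    rw [polyPotential, h, ← Real.rpow_mul hs.le]
    have h2 : -(1 / q) * -q = 1 := by field_simp
    rw [h2, Real.rpow_one]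
  have hmem : -(1 / η) * s ^ (-(1 / q)) ∈ Set.Iio (0 : ℝ) := by
    have : 0 < (1 / η) * s ^ (-(1 / q)) := by positivity
    simp only [Set.mem_Iio]; linarith
  have hex : ∃ x ∈ Set.Iio (0 : ℝ), polyPotential q η x = s := ⟨_, hmem, hpre⟩
  have h1 := Function.invFunOn_mem hex
  have h2 := Function.invFunOn_eq hex
  have hinj : Set.InjOn (polyPotential q η) (Set.Iio 0) := by
    intro x hx y hy hxy
    simp only [Set.mem_Iio] at hx hy
    have hx' : 0 ≤ -η * x := by nlinarith
    have hy' : 0 ≤ -η * y := by nlinarith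
    have := (Real.rpow_left_inj hx' hy' (neg_ne_zero.mpr hq0)).mp hxy
    exact mul_left_cancel₀ (neg_ne_zero.mpr hη.ne') this
  exact hinj h1 hmem (h2.trans hpre.symm)

/-- Closed form of the LINPOLY function on its domain. -/
theorem linpolyF_eq {d : ℕ} {q η : ℝ} (hq : 1 < q) (hη : 0 < η)
    {u : EuclideanSpace ℝ (Fin d)} (hu : u ∈ orthant d 0) :
    linpolyF q η u = -(q / ((q - 1) * η)) * ∑ i, u i ^ ((q - 1) / q) := by
  have hq0 : 0 < q := by positivity
  have hq1 : q - 1 ≠ 0 := by linarith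
  rw [linpolyF, lininfF, Finset.mul_sum]
  refine Finset.sum_congr rfl fun i _ => ?_
  have hc : ∫ s in (0 : ℝ)..u i, Function.invFunOn (polyPotential q η) (Set.Iio 0) s =
      ∫ s in (0 : ℝ)..u i, -(1 / η) * s ^ (-(1 / q)) := by
    refine intervalIntegral.integral_congr_ae (Filter.Eventually.of_forall fun s hs => ?_)
    rw [Set.uIoc_of_le (hu i)] at hs
    exact invFunOn_polyPotential hq hη hs.1
  have hlt : -1 < -(1 / q) := by
    have : 1 / q < 1 := by rw [div_lt_one hq0]; exact hq
    linarith
  have he : -(1 / q) + 1 = (q - 1) / q := by field_simp; ring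
  rw [hc, intervalIntegral.integral_const_mul, integral_rpow (Or.inl hlt), he,
    Real.zero_rpow (div_ne_zero hq1 hq0.ne')]
  field_simp
  ring

end

/-! This is mirror descent with a separable potential. On each trajectory and for each `u ∈ S`, the
three-point identity and the Pythagorean inequality for Bregman projections telescope to bound the
estimated regret by the divergence from `u` to the all-ones vector plus one divergence per gradient
step (`IsCleb.sum_estimate_le`). The first term is at most `d / ((q - 1) * η)`. In the dual
coordinate `x ^ (-(1 / q))` a gradient step is a translation, so a coordinate of a step costs a
Taylor remainder of `z ^ (-(q - 1))`, at most `q * η / 2 * l ^ 2 * x ^ (1 + 1 / q)`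
(`linpolyTermDiv_le`).

With `l = ℓ * V / w` and `ℓ, V ≤ 1`, the factor after `q * η / 2` is at most `w ^ (1 / q - 1) * V`,
whose conditional mean is `w ^ (1 / q) ≤ 1`. The estimates are unbiased, so taking expectations
gives `d / ((q - 1) * η) + n * d * q * η / 2`, and the prescribed `η` makes the two terms equal. -/

/-! ### Scalar estimates for the power potential. -/

/-- Second-order Taylor bound for `x ↦ x ^ (-p)` at `1`, to the right of `1`. -/
theorem rpow_neg_le_taylor_two {p x : ℝ} (hp : 0 < p) (hx : 1 ≤ x) :
    x ^ (-p) ≤ 1 - p * (x - 1) + p * (p + 1) / 2 * (x - 1) ^ 2 := by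
  set k : ℝ → ℝ := fun x => 1 - p * (x - 1) + p * (p + 1) / 2 * (x - 1) ^ 2 - x ^ (-p) with hk
  have hd : ∀ y : ℝ, 0 < y →
      HasDerivAt k (-p + p * (p + 1) * (y - 1) + p * y ^ (-(p + 1))) y := by
    intro y hy
    have h1 : HasDerivAt (fun x : ℝ => x - 1) 1 y := (hasDerivAt_id y).sub_const 1
    have h2 := (((h1.const_mul p).const_sub 1).add ((h1.pow 2).const_mul (p * (p + 1) / 2))).sub
      (Real.hasDerivAt_rpow_const (p := -p) (Or.inl hy.ne'))
    refine h2.congr_deriv ?_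
    have : -p - 1 = -(p + 1) := by ring
    rw [this]
    push_cast
    ring
  have hmono : MonotoneOn k (Set.Ici 1) := by
    refine monotoneOn_of_deriv_nonneg (convex_Ici 1) ?_ ?_ ?_
    · exact fun y hy => (hd y (zero_lt_one.trans_le hy)).continuousAt.continuousWithinAt
    · intro y hy
      rw [interior_Ici] at hy
      exact (hd y (zero_lt_one.trans hy)).differentiableAt.differentiableWithinAt
    · intro y hy
      rw [interior_Ici] at hy
      have hy1 : (1 : ℝ) < y := hy
      rw [(hd y (zero_lt_one.trans hy)).deriv]
      -- The convex function `y ^ (-(p + 1))` lies above its tangent at `1`; this is the sign of the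
      -- derivative of `k`.
      have hb : 1 - (p + 1) * (y - 1) ≤ y ^ (-(p + 1)) := by
        have hy0 := zero_lt_one.trans hy1
        rw [Real.rpow_def_of_pos hy0]
        have h1 := Real.add_one_le_exp (Real.log y * -(p + 1))
        have h2 := mul_le_mul_of_nonneg_left (Real.log_le_sub_one_of_pos hy0)
          (show 0 ≤ p + 1 by linarith)
        linarith
      nlinarith [mul_le_mul_of_nonneg_left hb hp.le]
  have h := hmono (Set.mem_Ici.2 le_rfl) (Set.mem_Ici.2 hx) hx
  simp only [hk, sub_self, Real.one_rpow] at h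
  linarith

/-- The summand of `linpolyF`. -/
noncomputable def linpolyTerm (q η x : ℝ) : ℝ := -(q / ((q - 1) * η)) * x ^ ((q - 1) / q)

/-- The derivative of `linpolyTerm`. -/
noncomputable def linpolyTermDeriv (q η x : ℝ) : ℝ := -(1 / η) * x ^ (-(1 / q))

/-- The scalar Bregman divergence of `linpolyTerm`. -/
noncomputable def linpolyTermDiv (q η x y : ℝ) : ℝ :=
  linpolyTerm q η x - linpolyTerm q η y - (x - y) * linpolyTermDeriv q η y

theorem hasDerivAt_linpolyTerm {q η x : ℝ} (hq : 1 < q) (hx : 0 < x) :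
    HasDerivAt (linpolyTerm q η) (linpolyTermDeriv q η x) x := by
  refine ((Real.hasDerivAt_rpow_const (p := (q - 1) / q) (Or.inl hx.ne')).const_mul
    (-(q / ((q - 1) * η)))).congr_deriv ?_
  have hq0 : q ≠ 0 := by positivity
  have hq1 : q - 1 ≠ 0 := by linarith
  have he : (q - 1) / q - 1 = -(1 / q) := by field_simp; ring
  rw [he, linpolyTermDeriv]
  field_simp

/-- Bernoulli's inequality at `x / y` for the exponent `(q - 1) / q` in `(0, 1]`. The case `x = 0`
is needed because comparators are 0/1 vectors. -/
theorem linpolyTermDiv_nonneg {q η x y : ℝ} (hq : 1 < q) (hη : 0 < η) (hx : 0 ≤ x) (hy : 0 < y) :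
    0 ≤ linpolyTermDiv q η x y := by
  have hq0 : 0 < q := by positivity
  have hq1 : 0 < q - 1 := by linarith
  have hb := rpow_one_add_le_one_add_mul_self (s := x / y - 1) (p := (q - 1) / q)
    (by have : 0 ≤ x / y := by positivity
        linarith) (by positivity) (by rw [div_le_one hq0]; linarith)
  rw [add_sub_cancel, Real.div_rpow hx hy.le, div_le_iff₀ (by positivity)] at hb
  have hy' : y ^ ((q - 1) / q) = y * y ^ (-(1 / q)) := by
    have he : (q - 1) / q = 1 + -(1 / q) := by field_simp; ring
    rw [he, Real.rpow_add hy, Real.rpow_one]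
  have hpos : 0 < y ^ (-(1 / q)) := by positivity
  rw [linpolyTermDiv, linpolyTerm, linpolyTerm, linpolyTermDeriv]
  rw [hy'] at hb ⊢
  have h2 := mul_le_mul_of_nonneg_left hb (show 0 ≤ q / ((q - 1) * η) by positivity)
  have h3 : q / ((q - 1) * η) * ((1 + (q - 1) / q * (x / y - 1)) * (y * y ^ (-(1 / q)))) =
      q / ((q - 1) * η) * (y * y ^ (-(1 / q))) + (x - y) * (1 / η * y ^ (-(1 / q))) := by
    field_simp
  linarith

/-- By duality: with `a = x ^ (-(1 / q))` and `b = y ^ (-(1 / q))`, the hypothesis reads `b = a + η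
* l`, and the divergence equals the first-order Taylor remainder of `z ^ (-(q - 1))` from `a` to
`b`, divided by `(q - 1) * η`. Since `l ≥ 0`, only the Taylor bound to the right of `1`, at `b / a`,
is needed. -/
theorem linpolyTermDiv_le {q η x y l : ℝ} (hq : 1 < q) (hη : 0 < η) (hx : 0 < x) (hy : 0 < y)
    (hl : 0 ≤ l) (h : linpolyTermDeriv q η y = linpolyTermDeriv q η x - l) :
    linpolyTermDiv q η x y ≤ q * η / 2 * (l ^ 2 * x ^ (1 + 1 / q)) := by
  have hq0 : 0 < q := by positivity
  have hq1 : 0 < q - 1 := by linarith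
  have key : ∀ z : ℝ, 0 < z → ∀ s : ℝ, (z ^ (-(1 / q))) ^ s = z ^ (-(s / q)) := by
    intro z hz s
    rw [← Real.rpow_mul hz.le]
    congr 1
    ring
  set a := x ^ (-(1 / q)) with ha
  set b := y ^ (-(1 / q)) with hb
  have ha0 : 0 < a := by positivity
  have hb0 : 0 < b := by positivity
  have hab : b = a + η * l := by
    simp only [linpolyTermDeriv, ← ha, ← hb] at h
    field_simp at h
    linarith
  have hx1 : x = a ^ (-q) := by
    rw [ha, key x hx, neg_div, neg_neg, div_self hq0.ne', Real.rpow_one]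
  have hy1 : y = b ^ (-q) := by
    rw [hb, key y hy, neg_div, neg_neg, div_self hq0.ne', Real.rpow_one]
  have hr := rpow_neg_le_taylor_two (p := q - 1) (x := b / a) hq1
    (by rw [one_le_div ha0, hab]; nlinarith [mul_nonneg hη.le hl])
  rw [Real.div_rpow hb0.le ha0.le, div_le_iff₀ (by positivity)] at hr
  have hpow : ∀ z : ℝ, 0 < z → z ^ (-(q - 1)) = z * z ^ (-q) := by
    intro z hz
    rw [show -(q - 1) = 1 + -q by ring, Real.rpow_add hz, Real.rpow_one]
  have e1 : x ^ ((q - 1) / q) = a * x := by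
    rw [hx1, ← hpow a ha0, ← Real.rpow_mul ha0.le]
    congr 1
    field_simp
  have e2 : y ^ ((q - 1) / q) = b * y := by
    rw [hy1, ← hpow b hb0, ← Real.rpow_mul hb0.le]
    congr 1
    field_simp
  have e3 : x ^ (1 + 1 / q) = x / a := by
    rw [Real.rpow_add hx, Real.rpow_one, ha, Real.rpow_neg hx.le, div_inv_eq_mul]
  rw [hpow a ha0, hpow b hb0, ← hx1, ← hy1] at hr
  rw [linpolyTermDiv, linpolyTerm, linpolyTerm, linpolyTermDeriv, e1, e2, e3, ← hb]
  have hl' : l = (b - a) / η := by rw [hab]; field_simp; ring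
  have h2 := mul_le_mul_of_nonneg_left hr (show 0 ≤ 1 / ((q - 1) * η) by positivity)
  have h3 : 1 / ((q - 1) * η) * ((1 - (q - 1) * (b / a - 1) +
        (q - 1) * (q - 1 + 1) / 2 * (b / a - 1) ^ 2) * (a * x)) =
      q * η / 2 * (l ^ 2 * (x / a)) + q / ((q - 1) * η) * (a * x) - 1 / η * x * b := by
    rw [hl']
    field_simp
    ring
  have h4 : 1 / ((q - 1) * η) * (b * y) = q / ((q - 1) * η) * (b * y) - 1 / η * y * b := by
    field_simp
    ring
  rw [h3, h4] at h2
  linarith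

/-! ### The separable potential: gradient and Bregman divergence. -/

theorem interior_orthant_zero_pos {d : ℕ} {u : EuclideanSpace ℝ (Fin d)}
    (hu : u ∈ interior (orthant d 0)) (i : Fin d) : 0 < u i := by
  have hopen : IsOpenMap (EuclideanSpace.proj i : EuclideanSpace ℝ (Fin d) →L[ℝ] ℝ) :=
    ContinuousLinearMap.isOpenMap _ fun c => ⟨EuclideanSpace.single i c, by simp⟩
  have h : (EuclideanSpace.proj i : EuclideanSpace ℝ (Fin d) →L[ℝ] ℝ) ''
      interior (orthant d 0) ⊆ interior (Set.Ici 0) := by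
    refine interior_maximal ?_ (hopen _ isOpen_interior)
    rintro _ ⟨v, hv, rfl⟩
    exact interior_subset hv i
  rw [interior_Ici] at h
  exact h ⟨u, hu, rfl⟩

theorem mem_interior_orthant_zero {d : ℕ} {u : EuclideanSpace ℝ (Fin d)} (hu : ∀ i, 0 < u i) :
    u ∈ interior (orthant d 0) := by
  have ho : IsOpen {v : EuclideanSpace ℝ (Fin d) | ∀ i, 0 < v i} := by
    simp only [Set.ofPred_forall]
    exact isOpen_iInter_of_finite fun i =>
      isOpen_lt continuous_const (EuclideanSpace.proj i : _ →L[ℝ] ℝ).continuous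
  exact interior_maximal (fun v hv i => (hv i).le) ho hu

theorem linpolyF_eq_sum_linpolyTerm {d : ℕ} {q η : ℝ} (hq : 1 < q) (hη : 0 < η)
    {u : EuclideanSpace ℝ (Fin d)} (hu : ∀ i, 0 ≤ u i) :
    linpolyF q η u = ∑ i, linpolyTerm q η (u i) := by
  rw [linpolyF_eq hq hη hu, Finset.mul_sum]
  rfl

theorem gradient_linpolyF {d : ℕ} {q η : ℝ} (hq : 1 < q) (hη : 0 < η)
    {u : EuclideanSpace ℝ (Fin d)} (hu : ∀ i, 0 < u i) :
    ∇ (linpolyF q η) u = WithLp.toLp 2 fun i => linpolyTermDeriv q η (u i) := by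
  refine HasGradientAt.gradient ?_
  have hsum : HasFDerivAt (fun v : EuclideanSpace ℝ (Fin d) => ∑ i, linpolyTerm q η (v i))
      (∑ i, linpolyTermDeriv q η (u i) •
        (EuclideanSpace.proj i : EuclideanSpace ℝ (Fin d) →L[ℝ] ℝ)) u := by
    refine HasFDerivAt.fun_sum fun i _ => ?_
    exact HasDerivAt.comp_hasFDerivAt (h₂ := linpolyTerm q η) u
      (hasDerivAt_linpolyTerm hq (hu i))
      (EuclideanSpace.proj i : EuclideanSpace ℝ (Fin d) →L[ℝ] ℝ).hasFDerivAt
  -- The closed form is known only on the orthant, but a gradient depends only on a neighbourhood of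
  -- the interior point `u`.
  have heq : linpolyF q η =ᶠ[nhds u]
      fun v : EuclideanSpace ℝ (Fin d) => ∑ i, linpolyTerm q η (v i) := by
    filter_upwards [isOpen_interior.mem_nhds (mem_interior_orthant_zero hu)] with v hv
    exact linpolyF_eq_sum_linpolyTerm hq hη fun i => (interior_orthant_zero_pos hv i).le
  rw [hasGradientAt_iff_hasFDerivAt]
  refine (hsum.congr_of_eventuallyEq heq).congr_fderiv ?_
  ext v
  simp [PiLp.inner_apply, mul_comm]

/-- The Bregman divergence of `linpolyF`, coordinatewise. -/
noncomputable def linpolyDiv {d : ℕ} (q η : ℝ) (u v : EuclideanSpace ℝ (Fin d)) : ℝ :=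
  ∑ i, linpolyTermDiv q η (u i) (v i)

theorem bregmanDiv_linpolyF {d : ℕ} {q η : ℝ} (hq : 1 < q) (hη : 0 < η)
    {u v : EuclideanSpace ℝ (Fin d)} (hu : ∀ i, 0 ≤ u i) (hv : ∀ i, 0 < v i) :
    bregmanDiv (linpolyF q η) u v = linpolyDiv q η u v := by
  rw [bregmanDiv, linpolyF_eq_sum_linpolyTerm hq hη hu,
    linpolyF_eq_sum_linpolyTerm hq hη fun i => (hv i).le, gradient_linpolyF hq hη hv, linpolyDiv,
    ← Finset.sum_sub_distrib, PiLp.inner_apply, ← Finset.sum_sub_distrib]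
  refine Finset.sum_congr rfl fun i _ => ?_
  simp [linpolyTermDiv, mul_comm]

theorem linpolyDiv_nonneg {d : ℕ} {q η : ℝ} (hq : 1 < q) (hη : 0 < η)
    {u v : EuclideanSpace ℝ (Fin d)} (hu : ∀ i, 0 ≤ u i) (hv : ∀ i, 0 < v i) :
    0 ≤ linpolyDiv q η u v :=
  Finset.sum_nonneg fun i _ => linpolyTermDiv_nonneg hq hη (hu i) (hv i)

/-- The law of cosines for Bregman divergences: the potential values cancel, so no sign condition is
needed. -/
theorem linpolyDiv_three_point {d : ℕ} (q η : ℝ) (u v w : EuclideanSpace ℝ (Fin d)) :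
    linpolyDiv q η u v + linpolyDiv q η v w - linpolyDiv q η u w =
      ∑ i, (linpolyTermDeriv q η (v i) - linpolyTermDeriv q η (w i)) * (v i - u i) := by
  simp only [linpolyDiv, ← Finset.sum_add_distrib, ← Finset.sum_sub_distrib]
  refine Finset.sum_congr rfl fun i _ => ?_
  simp only [linpolyTermDiv]
  ring

/-! ### Mirror descent along one trajectory. -/

/-- Generalised Pythagorean inequality for the Bregman projection onto a convex set. -/
theorem linpolyDiv_le_of_isMinOn {d : ℕ} {q η : ℝ} (hq : 1 < q) (hη : 0 < η)
    {C : Set (EuclideanSpace ℝ (Fin d))} (hC : Convex ℝ C)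
    {u v w : EuclideanSpace ℝ (Fin d)} (hu : u ∈ C) (hu0 : ∀ i, 0 ≤ u i)
    (hv : v ∈ C) (hv0 : ∀ i, 0 < v i) (hw : ∀ i, 0 < w i)
    (hmin : IsMinOn (fun x => bregmanDiv (linpolyF q η) x w) (C ∩ interior (orthant d 0)) v) :
    linpolyDiv q η u v ≤ linpolyDiv q η u w := by
  set γ : ℝ → ℝ := fun s => ∑ i, linpolyTermDiv q η (v i + s * (u i - v i)) (w i) with hγ
  have hder : HasDerivAt γ (∑ i, (linpolyTermDeriv q η (v i) - linpolyTermDeriv q η (w i)) *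
      (u i - v i)) 0 := by
    refine HasDerivAt.fun_sum fun i _ => ?_
    have h1 : HasDerivAt (fun s : ℝ => v i + s * (u i - v i)) (u i - v i) 0 := by
      simpa using ((hasDerivAt_id (0 : ℝ)).mul_const (u i - v i)).const_add (v i)
    have h2 : HasDerivAt (linpolyTerm q η) (linpolyTermDeriv q η (v i))
        (v i + 0 * (u i - v i)) := by
      simpa using hasDerivAt_linpolyTerm (η := η) hq (hv0 i)
    refine (((h2.comp (0 : ℝ) h1).sub_const (linpolyTerm q η (w i))).sub
      ((h1.sub_const (w i)).mul_const (linpolyTermDeriv q η (w i)))).congr_deriv ?_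
    ring
  -- `s = 1` is excluded: `u` may have zero coordinates, whereas for `s < 1` the point of the
  -- segment is strictly positive and competes with the minimiser `v`.
  have hmem : ∀ s ∈ Set.Ico (0 : ℝ) 1, γ 0 ≤ γ s := by
    intro s hs
    set x := v + s • (u - v) with hx
    have hx0 : ∀ i, 0 < x i := by
      intro i
      have : x i = (1 - s) * v i + s * u i := by
        simp [hx]
        ring
      rw [this]
      exact add_pos_of_pos_of_nonneg (mul_pos (by linarith [hs.2]) (hv0 i))
        (mul_nonneg hs.1 (hu0 i))
    have h := hmin ⟨hC.add_smul_sub_mem hv hu ⟨hs.1, hs.2.le⟩, mem_interior_orthant_zero hx0⟩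
    simp only [Set.mem_ofPred_eq] at h
    rw [bregmanDiv_linpolyF hq hη (fun i => (hv0 i).le) hw,
      bregmanDiv_linpolyF hq hη (fun i => (hx0 i).le) hw] at h
    simpa [hγ, hx, linpolyDiv] using h
  -- First-order optimality: the right difference quotients of `γ` at `0` are nonnegative.
  have hnn : 0 ≤ ∑ i, (linpolyTermDeriv q η (v i) - linpolyTermDeriv q η (w i)) *
      (u i - v i) := by
    have ht := hder.tendsto_slope_zero_right
    refine ge_of_tendsto ht ?_
    filter_upwards [Ioo_mem_nhdsGT (zero_lt_one (α := ℝ))] with s hs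
    rw [zero_add, smul_eq_mul]
    exact mul_nonneg (inv_nonneg.2 hs.1.le) (sub_nonneg.2 (hmem s ⟨hs.1.le, hs.2⟩))
  have h3 := linpolyDiv_three_point q η u v w
  have h4 := linpolyDiv_nonneg hq hη (fun i => (hv0 i).le) hw
  have h5 : ∑ i, (linpolyTermDeriv q η (v i) - linpolyTermDeriv q η (w i)) * (v i - u i) =
      -∑ i, (linpolyTermDeriv q η (v i) - linpolyTermDeriv q η (w i)) * (u i - v i) := by
    rw [← Finset.sum_neg_distrib]
    exact Finset.sum_congr rfl fun i _ => by ring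
  linarith

/-- A coordinate equal to `1` contributes nothing, and a coordinate equal to `0` contributes exactly
`1 / ((q - 1) * η)`. -/
theorem linpolyDiv_one_le {d : ℕ} {q η : ℝ} (hq : 1 < q) (hη : 0 < η)
    {u : EuclideanSpace ℝ (Fin d)} (hu : ∀ i, u i = 0 ∨ u i = 1) :
    linpolyDiv q η u (WithLp.toLp 2 fun _ => (1 : ℝ)) ≤ d * (1 / ((q - 1) * η)) := by
  have hq0 : 0 < q := by positivity
  have hq1 : 0 < q - 1 := by linarith
  have h : ∀ i ∈ Finset.univ, linpolyTermDiv q η (u i) 1 ≤ 1 / ((q - 1) * η) := by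
    intro i _
    rcases hu i with h | h
    · rw [h, linpolyTermDiv, linpolyTerm, linpolyTerm, linpolyTermDeriv,
        Real.zero_rpow (by positivity), Real.one_rpow, Real.one_rpow]
      refine le_of_eq ?_
      field_simp
      ring
    · rw [h, linpolyTermDiv, sub_self, sub_self, zero_mul, sub_zero]
      positivity
  simpa [linpolyDiv] using Finset.sum_le_sum h

/-- Regret of mirror descent with potential `linpolyF` against estimated losses. -/
theorem IsCleb.sum_estimate_le {d n : ℕ} {q η : ℝ} (hq : 1 < q) (hη : 0 < η)
    {S : Finset (EuclideanSpace ℝ (Fin d))} (hS01 : ∀ v ∈ S, ∀ i, v i = 0 ∨ v i = 1)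
    {est w : ℕ → EuclideanSpace ℝ (Fin d)} {p : ℕ → EuclideanSpace ℝ (Fin d) → ℝ}
    (h : IsCleb (orthant d 0) (linpolyF q η) S n est w p)
    (hw : IsArgminOn
      (fun u => bregmanDiv (linpolyF q η) u (WithLp.toLp 2 fun _ => (1 : ℝ)))
      (convexHull ℝ (S : Set (EuclideanSpace ℝ (Fin d)))) (w 0))
    (hest : ∀ t < n, ∀ i, 0 ≤ est t i) {u : EuclideanSpace ℝ (Fin d)} (hu : u ∈ S) :
    ∑ t ∈ Finset.range n, ∑ i, est t i * (w t i - u i) ≤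
      d * (1 / ((q - 1) * η)) +
        ∑ t ∈ Finset.range n, ∑ i, q * η / 2 * (est t i ^ 2 * w t i ^ (1 + 1 / q)) := by
  have hu0 : ∀ i, 0 ≤ u i := fun i => by rcases hS01 u hu i with h | h <;> rw [h]; norm_num
  have huC := subset_convexHull ℝ (S : Set (EuclideanSpace ℝ (Fin d))) hu
  have hpos : ∀ t ≤ n, w t ∈ convexHull ℝ (S : Set (EuclideanSpace ℝ (Fin d))) ∩
      interior (orthant d 0) := by
    intro t ht
    cases t with
    | zero => exact h.init_mem
    | succ t =>
      obtain ⟨w', -, -, hw'⟩ := h.update t ht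
      exact hw'.1
  -- Keeping the divergence from `u` to the current iterate on the left makes the induction
  -- telescope.
  have main : ∀ m ≤ n, ∑ t ∈ Finset.range m, ∑ i, est t i * (w t i - u i) +
      linpolyDiv q η u (w m) ≤ d * (1 / ((q - 1) * η)) +
        ∑ t ∈ Finset.range m, ∑ i, q * η / 2 * (est t i ^ 2 * w t i ^ (1 + 1 / q)) := by
    intro m
    induction m with
    | zero =>
      intro _
      have h1 := linpolyDiv_le_of_isMinOn hq hη (convex_convexHull ℝ _) huC hu0 h.init_mem.1
        (fun i => interior_orthant_zero_pos h.init_mem.2 i) (fun i => by simp)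
        (hw.2.on_subset Set.inter_subset_left)
      have h2 := linpolyDiv_one_le hq hη (hS01 u hu)
      simp only [Finset.range_zero, Finset.sum_empty]
      linarith
    | succ m ih =>
      intro hm
      have ih := ih (by omega)
      obtain ⟨w', hw'i, hgrad, hmin⟩ := h.update m hm
      have hwm := fun i => interior_orthant_zero_pos (hpos m (by omega)).2 i
      have hw' := fun i => interior_orthant_zero_pos hw'i i
      rw [gradient_linpolyF hq hη hw', gradient_linpolyF hq hη hwm] at hgrad
      have hg : ∀ i, linpolyTermDeriv q η (w' i) = linpolyTermDeriv q η (w m i) - est m i :=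
        fun i => congrArg (fun x : EuclideanSpace ℝ (Fin d) => x i) hgrad
      have h1 := linpolyDiv_le_of_isMinOn hq hη (convex_convexHull ℝ _) huC hu0 hmin.1.1
        (fun i => interior_orthant_zero_pos hmin.1.2 i) hw' hmin.2
      have h2 := linpolyDiv_three_point q η u (w m) w'
      have h3 : linpolyDiv q η (w m) w' ≤
          ∑ i, q * η / 2 * (est m i ^ 2 * w m i ^ (1 + 1 / q)) :=
        Finset.sum_le_sum fun i _ =>
          linpolyTermDiv_le hq hη (hwm i) (hw' i) (hest m hm i) (hg i)
      have h4 : ∑ i, (linpolyTermDeriv q η (w m i) - linpolyTermDeriv q η (w' i)) *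
          (w m i - u i) = ∑ i, est m i * (w m i - u i) :=
        Finset.sum_congr rfl fun i _ => by rw [hg i]; ring
      rw [Finset.sum_range_succ, Finset.sum_range_succ]
      linarith
  have := main n le_rfl
  have h2 := linpolyDiv_nonneg hq hη hu0
    (fun i => interior_orthant_zero_pos (hpos n le_rfl).2 i)
  linarith

/-! ### Averaging over the draw of the action. -/

/-- On `m`, the restriction of `μ` to `A` and the measure with density `p` coincide, by the defining
property of conditional expectation; integrals of `m`-measurable functions see nothing else. Working
in `ENNReal` avoids any integrability or boundedness condition on `g`. -/
theorem setLIntegral_eq_lintegral_mul_of_condExp {Ω : Type*} {m mΩ : MeasurableSpace Ω}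
    (hm : m ≤ mΩ) {μ : Measure Ω} [IsFiniteMeasure μ] {A : Set Ω} (hA : MeasurableSet A)
    {p : Ω → ℝ} (hpm : Measurable[m] p) (hp0 : ∀ ω, 0 ≤ p ω)
    (hp : μ[A.indicator (fun _ => (1 : ℝ)) | m] =ᵐ[μ] p)
    {g : Ω → ENNReal} (hg : Measurable[m] g) :
    ∫⁻ ω in A, g ω ∂μ = ∫⁻ ω, g ω * ENNReal.ofReal (p ω) ∂μ := by
  have hint : Integrable (A.indicator (fun _ => (1 : ℝ))) μ :=
    (integrable_const 1).indicator hA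
  have hpint : Integrable p μ := integrable_condExp.congr hp
  have hmeas : Measurable fun ω => ENNReal.ofReal (p ω) := (hpm.mono hm le_rfl).ennreal_ofReal
  have htrim : (μ.restrict A).trim hm = (μ.withDensity fun ω => ENNReal.ofReal (p ω)).trim hm := by
    refine @Measure.ext _ m _ _ fun s hs => ?_
    rw [trim_measurableSet_eq hm hs, trim_measurableSet_eq hm hs, withDensity_apply _ (hm s hs),
      Measure.restrict_apply (hm s hs),
      ← ofReal_integral_eq_lintegral_ofReal hpint.integrableOn
        (Filter.Eventually.of_forall hp0)]
    have h1 := setIntegral_condExp hm hint hs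
    rw [setIntegral_congr_ae (hm s hs) (hp.mono fun ω h _ => h)] at h1
    rw [h1, setIntegral_indicator hA, setIntegral_const, smul_eq_mul, mul_one]
    exact (ofReal_measureReal (measure_ne_top _ _)).symm
  rw [← lintegral_trim hm hg, htrim, lintegral_trim hm hg,
    lintegral_withDensity_eq_lintegral_mul _ hmeas (hg.mono hm le_rfl)]
  simp only [Pi.mul_apply, mul_comm]

/-- Given the information available before round `t`, the action has mean `w`. -/
theorem IsGamePlay.integral_mul_action {d n : ℕ} {Ω : Type*} [mΩ : MeasurableSpace Ω]
    {μ : Measure Ω} [IsProbabilityMeasure μ] {𝒢 : Filtration ℕ mΩ}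
    {S : Finset (EuclideanSpace ℝ (Fin d))} (hS0 : ∀ v ∈ S, ∀ i, 0 ≤ v i)
    {ℓ V : ℕ → Ω → EuclideanSpace ℝ (Fin d)} {p : ℕ → Ω → EuclideanSpace ℝ (Fin d) → ℝ}
    (h : IsGamePlay μ 𝒢 S n ℓ V p) {t : ℕ} (ht : t < n) {w : Ω → EuclideanSpace ℝ (Fin d)}
    (hp0 : ∀ ω, ∀ v ∈ S, 0 ≤ p t ω v) (hw : ∀ ω, ∑ v ∈ S, p t ω v • v = w ω)
    {g : Ω → ℝ} (hg : Measurable[𝒢 t] g) (hg0 : ∀ ω, 0 ≤ g ω) (i : Fin d)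
    (hint : Integrable (fun ω => g ω * w ω i) μ) :
    Integrable (fun ω => g ω * V t ω i) μ ∧
      ∫ ω, g ω * V t ω i ∂μ = ∫ ω, g ω * w ω i ∂μ := by
  have hVm : Measurable (V t) := (h.action_measurable t ht).mono (𝒢.le _) le_rfl
  have hgm : Measurable g := hg.mono (𝒢.le t) le_rfl
  have hV0 : ∀ ω, 0 ≤ g ω * V t ω i := fun ω =>
    mul_nonneg (hg0 ω) (hS0 _ (h.action_mem t ht ω) i)
  have hwi : ∀ ω, w ω i = ∑ v ∈ S, p t ω v * v i := by
    intro ω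
    rw [← hw ω]
    simp
  have hw0 : ∀ ω, 0 ≤ g ω * w ω i := fun ω => by
    rw [hwi]
    exact mul_nonneg (hg0 ω) (Finset.sum_nonneg fun v hv => mul_nonneg (hp0 ω v hv) (hS0 v hv i))
  have hsm : Measurable fun ω => g ω * V t ω i :=
    hgm.mul ((EuclideanSpace.proj i : EuclideanSpace ℝ (Fin d) →L[ℝ] ℝ).measurable.comp hVm)
  have hA : ∀ v, MeasurableSet (V t ⁻¹' {v}) := fun v => hVm (measurableSet_singleton v)
  -- Split according to the action drawn. Equality of lower integrals yields integrability as well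
  -- as equality of the means, even for unbounded `g`.
  have hlin : ∫⁻ ω, ENNReal.ofReal (g ω * V t ω i) ∂μ =
      ∫⁻ ω, ENNReal.ofReal (g ω * w ω i) ∂μ := by
    have e1 : ∀ ω, ENNReal.ofReal (g ω * V t ω i) = ∑ v ∈ S,
        (V t ⁻¹' {v}).indicator (fun ω => ENNReal.ofReal (g ω * v i)) ω := by
      intro ω
      rw [Finset.sum_eq_single_of_mem (V t ω) (h.action_mem t ht ω)]
      · simp
      · intro v _ hv
        exact Set.indicator_of_notMem (s := V t ⁻¹' {v})
          (fun hmem => hv (Set.mem_singleton_iff.1 hmem).symm)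
          (fun ω => ENNReal.ofReal (g ω * v i))
    have e2 : ∀ ω, ENNReal.ofReal (g ω * w ω i) = ∑ v ∈ S,
        ENNReal.ofReal (g ω * v i) * ENNReal.ofReal (p t ω v) := by
      intro ω
      rw [hwi, Finset.mul_sum, ENNReal.ofReal_sum_of_nonneg fun v hv =>
        mul_nonneg (hg0 ω) (mul_nonneg (hp0 ω v hv) (hS0 v hv i))]
      refine Finset.sum_congr rfl fun v hv => ?_
      rw [← ENNReal.ofReal_mul (mul_nonneg (hg0 ω) (hS0 v hv i))]
      congr 1
      ring
    simp only [e1, e2]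
    have hgv : ∀ v : EuclideanSpace ℝ (Fin d),
        Measurable[𝒢 t] fun ω => ENNReal.ofReal (g ω * v i) :=
      fun v => (hg.mul_const (v i)).ennreal_ofReal
    rw [lintegral_finsetSum' _ fun v _ =>
        (((hgv v).mono (𝒢.le t) le_rfl).indicator (hA v)).aemeasurable,
      lintegral_finsetSum' (f := fun v ω => ENNReal.ofReal (g ω * v i) * ENNReal.ofReal (p t ω v))
        _ fun v hv => (((hgv v).mono (𝒢.le t) le_rfl).mul
          ((h.prob_measurable t ht v hv).mono (𝒢.le t) le_rfl).ennreal_ofReal).aemeasurable]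
    refine Finset.sum_congr rfl fun v hv => ?_
    rw [lintegral_indicator (hA v)]
    exact setLIntegral_eq_lintegral_mul_of_condExp (𝒢.le t) (hA v)
      (h.prob_measurable t ht v hv) (fun ω => hp0 ω v hv) (h.action_law t ht v hv) (hgv v)
  have hfin := (hasFiniteIntegral_iff_ofReal (Filter.Eventually.of_forall hw0)).1 hint.2
  refine ⟨⟨hsm.aestronglyMeasurable,
    (hasFiniteIntegral_iff_ofReal (Filter.Eventually.of_forall hV0)).2 (hlin ▸ hfin)⟩, ?_⟩
  rw [integral_eq_lintegral_of_nonneg_ae (Filter.Eventually.of_forall hV0)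
      hsm.aestronglyMeasurable,
    integral_eq_lintegral_of_nonneg_ae (Filter.Eventually.of_forall hw0) hint.1, hlin]

/-! ### The regret bound in expectation. -/

theorem mainTheorem7 {d n : ℕ} (hn : 0 < n) {q η : ℝ} (hq : 1 < q)
    (hη : η = Real.sqrt (2 / (q * (q - 1) * (n : ℝ))))
    (S : Finset (EuclideanSpace ℝ (Fin d))) (hS : S.Nonempty)
    (hS01 : ∀ v ∈ S, ∀ i, v i = 0 ∨ v i = 1)
    {Ω : Type*} [mΩ : MeasurableSpace Ω] (μ : Measure Ω) [IsProbabilityMeasure μ]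
    (𝒢 : Filtration ℕ mΩ)
    (ℓ V w : ℕ → Ω → EuclideanSpace ℝ (Fin d))
    (p : ℕ → Ω → EuclideanSpace ℝ (Fin d) → ℝ)
    (hplay : IsGamePlay μ 𝒢 S n ℓ V p)
    (hL : LInftyAssumption n ℓ)
    (hcleb : ∀ ω, IsCleb (orthant d 0) (linpolyF q η) S n
      (fun t => importanceWeighted (ℓ t ω) (V t ω) (w t ω)) (fun t => w t ω) (fun t => p t ω))
    (hw : ∀ ω, IsArgminOn
      (fun u => bregmanDiv (linpolyF q η) u (WithLp.toLp 2 fun _ => (1 : ℝ)))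
      (convexHull ℝ (S : Set (EuclideanSpace ℝ (Fin d)))) (w 0 ω)) :
    regret μ S hS n ℓ V ≤ (d : ℝ) * Real.sqrt (2 * q * (n : ℝ) / (q - 1)) := by
  have hq0 : 0 < q := by positivity
  have hq1 : 0 < q - 1 := by linarith
  have hn0 : (0 : ℝ) < n := by exact_mod_cast hn
  have hη0 : 0 < η := by rw [hη]; positivity
  have hη2 : η ^ 2 = 2 / (q * (q - 1) * n) := by rw [hη, Real.sq_sqrt (by positivity)]
  have hS0 : ∀ v ∈ S, ∀ i, 0 ≤ v i := fun v hv i => by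
    rcases hS01 v hv i with h | h <;> rw [h]; norm_num
  have hS1 : ∀ v ∈ S, ∀ i, v i ≤ 1 := fun v hv i => by
    rcases hS01 v hv i with h | h <;> rw [h]; norm_num
  have hℓ1 : ∀ t < n, ∀ ω i, ℓ t ω i ≤ 1 := fun t ht ω i =>
    (le_abs_self _).trans ((norm_le_pi_norm (WithLp.ofLp (ℓ t ω)) i).trans (hL t ht ω))
  have hproj : ∀ i, Measurable fun x : EuclideanSpace ℝ (Fin d) => x i := fun i =>
    (EuclideanSpace.proj i : EuclideanSpace ℝ (Fin d) →L[ℝ] ℝ).measurable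
  have hℓm : ∀ t < n, ∀ i, Measurable[𝒢 t] fun ω => ℓ t ω i := fun t ht i =>
    (hproj i).comp (hplay.loss_measurable t ht)
  have hVm : ∀ t < n, ∀ i, Measurable fun ω => V t ω i := fun t ht i =>
    (hproj i).comp ((hplay.action_measurable t ht).mono (𝒢.le _) le_rfl)
  have hwi : ∀ t < n, ∀ ω i, w t ω i = ∑ v ∈ S, p t ω v * v i := by
    intro t ht ω i
    rw [← (hcleb ω).prob_mean t ht]
    simp
  have hwm : ∀ t < n, ∀ i, Measurable[𝒢 t] fun ω => w t ω i := by
    intro t ht i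
    simp only [hwi t ht]
    exact Finset.measurable_fun_sum _ fun v hv => (hplay.prob_measurable t ht v hv).mul_const _
  have hw1 : ∀ t < n, ∀ ω i, w t ω i ≤ 1 := by
    intro t ht ω i
    rw [hwi t ht, ← (hcleb ω).prob_sum t ht]
    exact Finset.sum_le_sum fun v hv =>
      mul_le_of_le_one_right ((hcleb ω).prob_nonneg t ht v hv) (hS1 v hv i)
  have hw0 : ∀ t < n, ∀ ω i, 0 < w t ω i := by
    intro t ht ω i
    cases t with
    | zero => exact interior_orthant_zero_pos (hcleb ω).init_mem.2 i
    | succ t =>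
      obtain ⟨w', -, -, hw'⟩ := (hcleb ω).update t (by omega)
      exact interior_orthant_zero_pos hw'.1.2 i
  have hbdd : ∀ f : Ω → ℝ, Measurable f → (∀ ω, 0 ≤ f ω) → (∀ ω, f ω ≤ 1) → Integrable f μ :=
    fun f hf h0 h1 => Integrable.of_bound hf.aestronglyMeasurable 1
      (Filter.Eventually.of_forall fun ω => by
        rw [Real.norm_of_nonneg (h0 ω)]
        exact h1 ω)
  have hV0 : ∀ t < n, ∀ ω i, 0 ≤ V t ω i := fun t ht ω => hS0 _ (hplay.action_mem t ht ω)
  have hV1 : ∀ t < n, ∀ ω i, V t ω i ≤ 1 := fun t ht ω => hS1 _ (hplay.action_mem t ht ω)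
  have hℓint : ∀ t < n, ∀ i, Integrable (fun ω => ℓ t ω i) μ := fun t ht i =>
    hbdd _ ((hℓm t ht i).mono (𝒢.le t) le_rfl) (fun ω => hplay.loss_nonneg t ht ω i)
      (fun ω => hℓ1 t ht ω i)
  have hℓVint : ∀ t < n, ∀ i, Integrable (fun ω => ℓ t ω i * V t ω i) μ := fun t ht i =>
    hbdd _ (((hℓm t ht i).mono (𝒢.le t) le_rfl).mul (hVm t ht i))
      (fun ω => mul_nonneg (hplay.loss_nonneg t ht ω i) (hV0 t ht ω i))
      (fun ω => mul_le_one₀ (hℓ1 t ht ω i) (hV0 t ht ω i) (hV1 t ht ω i))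
  -- Unbiasedness. No uniform lower bound on `w` is available, so `ℓ / w` may be unbounded; only its
  -- product with `w`, which is `ℓ`, has to be integrable.
  have hest : ∀ t < n, ∀ i, Integrable (fun ω => ℓ t ω i / w t ω i * V t ω i) μ ∧
      ∫ ω, ℓ t ω i / w t ω i * V t ω i ∂μ = ∫ ω, ℓ t ω i ∂μ := by
    intro t ht i
    have e : (fun ω => ℓ t ω i / w t ω i * w t ω i) = fun ω => ℓ t ω i :=
      funext fun ω => div_mul_cancel₀ _ (hw0 t ht ω i).ne'
    have := hplay.integral_mul_action (g := fun ω => ℓ t ω i / w t ω i) hS0 ht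
      (fun ω => (hcleb ω).prob_nonneg t ht) (fun ω => (hcleb ω).prob_mean t ht) ((hℓm t ht i).div (hwm t ht i))
      (fun ω => div_nonneg (hplay.loss_nonneg t ht ω i) (hw0 t ht ω i).le) i
      (by simp only [e]; exact hℓint t ht i)
    refine ⟨this.1, this.2.trans ?_⟩
    simp only [e]
  have hvar : ∀ t < n, ∀ i, Integrable (fun ω => w t ω i ^ (1 / q - 1) * V t ω i) μ ∧
      ∫ ω, w t ω i ^ (1 / q - 1) * V t ω i ∂μ ≤ 1 := by
    intro t ht i
    have e : (fun ω => w t ω i ^ (1 / q - 1) * w t ω i) = fun ω => w t ω i ^ (1 / q) :=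
      funext fun ω => by
        rw [Real.rpow_sub_one (hw0 t ht ω i).ne', div_mul_cancel₀ _ (hw0 t ht ω i).ne']
    have hle : ∀ ω, w t ω i ^ (1 / q) ≤ 1 := fun ω =>
      Real.rpow_le_one (hw0 t ht ω i).le (hw1 t ht ω i) (by positivity)
    have hi : Integrable (fun ω => w t ω i ^ (1 / q)) μ :=
      hbdd _ (((hwm t ht i).mono (𝒢.le t) le_rfl).pow_const _)
        (fun ω => Real.rpow_nonneg (hw0 t ht ω i).le _) hle
    have := hplay.integral_mul_action hS0 ht (fun ω => (hcleb ω).prob_nonneg t ht)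
      (fun ω => (hcleb ω).prob_mean t ht) ((hwm t ht i).pow_const (1 / q - 1))
      (fun ω => Real.rpow_nonneg (hw0 t ht ω i).le _) i
      (by simp only [e]; exact hi)
    refine ⟨this.1, this.2.trans_le ?_⟩
    simp only [e]
    simpa using integral_mono hi (integrable_const (1 : ℝ)) hle
  obtain ⟨u, huS, hu⟩ := S.exists_mem_eq_inf' hS
    (fun v => ∫ ω, ∑ t ∈ Finset.range n, inner ℝ (ℓ t ω) v ∂μ)
  -- The pathwise bound in terms of the true loss: the estimate paired with `w` is exactly the loss
  -- incurred.
  have hpt : ∀ ω, (∑ t ∈ Finset.range n, ∑ i, ℓ t ω i * V t ω i) -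
      ∑ t ∈ Finset.range n, ∑ i, ℓ t ω i / w t ω i * V t ω i * u i ≤
      d * (1 / ((q - 1) * η)) +
        ∑ t ∈ Finset.range n, ∑ i, q * η / 2 * (w t ω i ^ (1 / q - 1) * V t ω i) := by
    intro ω
    have hest0 : ∀ t < n, ∀ i,
        0 ≤ importanceWeighted (ℓ t ω) (V t ω) (w t ω) i := fun t ht i =>
      mul_nonneg (hplay.loss_nonneg t ht ω i) (div_nonneg (hV0 t ht ω i) (hw0 t ht ω i).le)
    have hmd := (hcleb ω).sum_estimate_le hq hη0 hS01 (hw ω) hest0 huS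
    refine le_trans (le_of_eq ?_) (hmd.trans ?_)
    · rw [← Finset.sum_sub_distrib]
      refine Finset.sum_congr rfl fun t ht => ?_
      rw [← Finset.sum_sub_distrib]
      refine Finset.sum_congr rfl fun i _ => ?_
      have := hw0 t (Finset.mem_range.1 ht) ω i
      simp only [importanceWeighted]
      field_simp
    · refine add_le_add le_rfl (Finset.sum_le_sum fun t ht => Finset.sum_le_sum fun i _ =>
        mul_le_mul_of_nonneg_left ?_ (by positivity))
      have ht := Finset.mem_range.1 ht
      have hwp := hw0 t ht ω i
      have e : w t ω i ^ (1 + 1 / q) = w t ω i ^ (1 / q - 1) * w t ω i ^ 2 := by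
        rw [← Real.rpow_natCast, ← Real.rpow_add hwp]
        congr 1
        push_cast
        ring
      have e2 : importanceWeighted (ℓ t ω) (V t ω) (w t ω) i ^ 2 * w t ω i ^ (1 + 1 / q) =
          w t ω i ^ (1 / q - 1) * (ℓ t ω i * V t ω i) ^ 2 := by
        rw [e]
        simp only [importanceWeighted]
        field_simp
      rw [e2]
      refine mul_le_mul_of_nonneg_left ?_ (Real.rpow_nonneg hwp.le _)
      have a1 := hV0 t ht ω i
      have a2 := mul_le_of_le_one_left a1 (hℓ1 t ht ω i)
      have a3 := mul_nonneg (hplay.loss_nonneg t ht ω i) a1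
      -- `(ℓ * V) ^ 2 ≤ V` because `0 ≤ ℓ * V ≤ V ≤ 1`.
      nlinarith [hV1 t ht ω i]
  have hI1 : Integrable (fun ω => ∑ t ∈ Finset.range n, ∑ i, ℓ t ω i * V t ω i) μ :=
    integrable_finsetSum _ fun t ht => integrable_finsetSum _ fun i _ =>
      hℓVint t (Finset.mem_range.1 ht) i
  have hI2 : Integrable
      (fun ω => ∑ t ∈ Finset.range n, ∑ i, ℓ t ω i / w t ω i * V t ω i * u i) μ :=
    integrable_finsetSum _ fun t ht => integrable_finsetSum _ fun i _ =>
      (hest t (Finset.mem_range.1 ht) i).1.mul_const _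
  have hI3 : Integrable (fun ω => ∑ t ∈ Finset.range n, ∑ i,
      q * η / 2 * (w t ω i ^ (1 / q - 1) * V t ω i)) μ :=
    integrable_finsetSum _ fun t ht => integrable_finsetSum _ fun i _ =>
      (hvar t (Finset.mem_range.1 ht) i).1.const_mul _
  have hE := integral_mono (hI1.sub hI2) ((integrable_const (d * (1 / ((q - 1) * η)))).add hI3) hpt
  simp only [Pi.sub_apply, Pi.add_apply] at hE
  rw [integral_sub hI1 hI2, integral_add (integrable_const _) hI3, integral_const,
    probReal_univ, one_smul] at hE
  -- The minimising `u` is deterministic, so unbiasedness replaces estimated losses by true ones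
  -- coordinate by coordinate.
  have hE2 : ∫ ω, ∑ t ∈ Finset.range n, ∑ i, ℓ t ω i / w t ω i * V t ω i * u i ∂μ =
      ∫ ω, ∑ t ∈ Finset.range n, ∑ i, ℓ t ω i * u i ∂μ := by
    rw [integral_finsetSum _ fun t ht => integrable_finsetSum _ fun i _ =>
        (hest t (Finset.mem_range.1 ht) i).1.mul_const _,
      integral_finsetSum _ fun t ht => integrable_finsetSum _ fun i _ =>
        (hℓint t (Finset.mem_range.1 ht) i).mul_const _]
    refine Finset.sum_congr rfl fun t ht => ?_
    have ht := Finset.mem_range.1 ht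
    rw [integral_finsetSum _ fun i _ => (hest t ht i).1.mul_const _,
      integral_finsetSum _ fun i _ => (hℓint t ht i).mul_const _]
    refine Finset.sum_congr rfl fun i _ => ?_
    rw [integral_mul_const, integral_mul_const, (hest t ht i).2]
  have hE3 : ∫ ω, ∑ t ∈ Finset.range n, ∑ i,
      q * η / 2 * (w t ω i ^ (1 / q - 1) * V t ω i) ∂μ ≤ n * (d * (q * η / 2)) := by
    rw [integral_finsetSum _ fun t ht => integrable_finsetSum _ fun i _ =>
        (hvar t (Finset.mem_range.1 ht) i).1.const_mul _]
    have : ∀ t ∈ Finset.range n, ∫ ω, ∑ i, q * η / 2 * (w t ω i ^ (1 / q - 1) * V t ω i) ∂μ ≤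
        d * (q * η / 2) := by
      intro t ht
      have ht := Finset.mem_range.1 ht
      rw [integral_finsetSum _ fun i _ => (hvar t ht i).1.const_mul _]
      have : ∀ i ∈ Finset.univ, ∫ ω, q * η / 2 * (w t ω i ^ (1 / q - 1) * V t ω i) ∂μ ≤
          q * η / 2 := by
        intro i _
        rw [integral_const_mul]
        exact mul_le_of_le_one_right (by positivity) (hvar t ht i).2
      simpa using Finset.sum_le_sum this
    simpa using Finset.sum_le_sum this
  have hinner : ∀ x y : EuclideanSpace ℝ (Fin d), inner ℝ x y = ∑ i, x i * y i := fun x y => by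
    simp [PiLp.inner_apply, mul_comm]
  rw [regret, hu]
  simp only [hinner]
  have hsqrt : Real.sqrt (2 * q * n / (q - 1)) = n * (q * η / 2) + 1 / ((q - 1) * η) := by
    -- The choice of `η` makes both summands equal to `n * q * η / 2`.
    have e : n * (q * η / 2) + 1 / ((q - 1) * η) = n * q * η := by
      have : η ^ 2 * (q * (q - 1) * n) = 2 := by rw [hη2]; field_simp
      field_simp
      linarith
    rw [e, Real.sqrt_eq_iff_mul_self_eq (by positivity) (by positivity)]
    have : n * q * η * (n * q * η) = n ^ 2 * q ^ 2 * η ^ 2 := by ring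
    rw [this, hη2]
    field_simp
  rw [hsqrt]
  linarith
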